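/- A \emph{left quasigroup} is an algebra $(Q,*,\backslash)$ with $x\backslash(x*y)=y=x*(x\backslash y)$; a \emph{quandle} is a left quasigroup satisfying $x*(y*z)=(x*y)*(x*z)$ and $x*x=x$. Let $L_a:b\mapsto a*b$ and $\mathrm{LMlt}(Q)=\langle L_a : a\in Q\rangle\le \mathrm{Sym}(Q)$. A left quasigroup $Q$ is \emph{connected} if $\mathrm{LMlt}(Q)$ is transitive on $Q$, and \emph{superconnected} if every subalgebra of $Q$ (subset closed under $*$ and $\backslash$) is connected. Let $\mathrm{Con}(Q)$ be the lattice of congruences of $(Q,*,\backslash)$, and $1_Q=Q\times Q$. For $\alpha\in\mathrm{Con}(Q)$ let $\mathrm{Dis}_\alpha$ be the smallest normal subgroup of $\mathrm{LMlt}(Q)$ containing $\{L_aL_b^{-1} : a\,\alpha\, b\}$, and put $\mathrm{Dis}(Q)=\mathrm{Dis}_{1_Q}$. Let $\mathrm{Norm}(Q)=\{N\trianglelefteq \mathrm{LMlt}(Q) : N\le \mathrm{Dis}(Q)\}$, and for $N\in\mathrm{Norm}(Q)$ let $\mathrm{con}_N=\{(a,b)\in Q\times Q : L_aL_b^{-1}\in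 N\}\in \mathrm{Con}(Q)$. (The maps $\mathrm{Dis}:\alpha\mapsto\mathrm{Dis}_\alpha$ and $\mathrm{con}:N\mapsto\mathrm{con}_N$ form a monotone Galois connection between $\mathrm{Con}(Q)$ and $\mathrm{Norm}(Q)$.) For $\alpha,\beta\in\mathrm{Con}(Q)$ the Freese--McKenzie commutator $[\alpha,\beta]$ is the smallest congruence $\delta$ such that for every term $t(\bar x,\bar y)$ and all tuples with $a_i\,\alpha\, b_i$ and $u_j\,\beta\, v_j$: if $t(\bar a,\bar u)\,\delta\, t(\bar a,\bar v)$ then $t(\bar b,\bar u)\,\delta\, t(\bar b,\bar v)$. \textbf{Proposition.} Let $Q$ be a superconnected quandle. Then: (i) $\alpha=\mathrm{con}_{\mathrm{Dis}_\alpha}$ and $[\alpha,\beta]=[\beta,\alpha]=\mathrm{con}_{[\mathrm{Dis}_\alpha,\mathrm{Dis}_\beta]}$ for all $\alpha,\beta\in\mathrm{Con}(Q)$, where $[\mathrm{Dis}_\alpha,\mathrm{Dis}_\beta]$ is the group commutator. (ii) The map $\mathrm{Dis}:\mathrm{Con}(Q)\to\mathrm{Norm}(Q)$ is injective and the map $\mathrm{con}:\mathrm{Norm}(Q)\to\mathrm{Con}(Q)$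 is surjective. -/

import Mathlib

namespace QuandleCommutator

open scoped Quandles

universe u

/-! ### Left multiplication group, connectedness, subalgebras -/

section Basic

variable (Q : Type u) [Rack Q]

/-- The left multiplication group `LMlt(Q) = ⟨L_a : a ∈ Q⟩`, where `L_a : b ↦ a ◃ b`. -/
def LMlt : Subgroup (Equiv.Perm Q) :=
  Subgroup.closure (Set.range fun a : Q => (Rack.act' a : Equiv.Perm Q))

/-- `Q` is connected if `LMlt(Q)` acts transitively on `Q`. -/
def IsConnected : Prop :=
  ∀ a b : Q, ∃ h ∈ LMlt Q, h a = b

/-- A subalgebra: a subset closed under the two operations `◃` and `◃⁻¹`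
(left division, `a ◃⁻¹ b = L_a⁻¹ b`). -/
structure Subalg where
  carrier : Set Q
  act_mem : ∀ {a b : Q}, a ∈ carrier → b ∈ carrier → a ◃ b ∈ carrier
  invAct_mem : ∀ {a b : Q}, a ∈ carrier → b ∈ carrier → a ◃⁻¹ b ∈ carrier

variable {Q}

/-- A subalgebra of a rack is a rack under the restricted operations. -/
instance Subalg.instRack (M : Subalg Q) : Rack M.carrier where
  act a b := ⟨a.1 ◃ b.1, M.act_mem a.2 b.2⟩
  self_distrib := Subtype.ext Shelf.self_distrib
  invAct a b := ⟨a.1 ◃⁻¹ b.1, M.invAct_mem a.2 b.2⟩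
  left_inv a b := Subtype.ext (Rack.left_inv a.1 b.1)
  right_inv a b := Subtype.ext (Rack.right_inv a.1 b.1)

variable (Q)

/-- `Q` is superconnected if every subalgebra of `Q` is connected. -/
def IsSuperconnected : Prop :=
  ∀ M : Subalg Q, IsConnected M.carrier

variable {Q}

/-- The left multiplication `L_a` as an element of `LMlt(Q)`. -/
def L (a : Q) : LMlt Q :=
  ⟨Rack.act' a, Subgroup.subset_closure ⟨a, rfl⟩⟩

theorem L_act (a b : Q) : L (a ◃ b) = L a * L b * (L a)⁻¹ :=
  Subtype.ext (Rack.ad_conj a b)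

theorem L_invAct (a b : Q) : L (a ◃⁻¹ b) = (L a)⁻¹ * L b * L a := by
  have h := L_act a (a ◃⁻¹ b)
  rw [Rack.act_invAct_eq] at h
  rw [h]; group

end Basic

/-! ### Congruences and the commutator of congruences -/

/-- A congruence of `Q`: an equivalence relation compatible with both operations. -/
@[ext]
structure Congr (Q : Type u) [Rack Q] extends Setoid Q where
  act_rel : ∀ {a b c d : Q}, toSetoid a b → toSetoid c d → toSetoid (a ◃ c) (b ◃ d)
  invAct_rel : ∀ {a b c d : Q}, toSetoid a b → toSetoid c d → toSetoid (a ◃⁻¹ c) (b ◃⁻¹ d)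

/-- Terms in the language of left quasigroups over the set of variables `X`. -/
inductive Term (X : Type) : Type
  | var : X → Term X
  | act : Term X → Term X → Term X
  | invAct : Term X → Term X → Term X

/-- The value of a term under an assignment of its variables. -/
def Term.eval {Q : Type u} [Rack Q] {X : Type} (e : X → Q) : Term X → Q
  | .var x => e x
  | .act s t => s.eval e ◃ t.eval e
  | .invAct s t => s.eval e ◃⁻¹ t.eval e

section Congr

variable {Q : Type u} [Rack Q]

/-- Congruences are ordered by inclusion. -/
instance : PartialOrder (Congr Q) :=
  PartialOrder.lift Congr.toSetoid fun _ _ h => Congr.ext (congrArg (fun s : Setoid Q => ⇑s) h)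

/-- The congruence `1_Q = Q × Q`. -/
def Congr.full (Q : Type u) [Rack Q] : Congr Q where
  toSetoid := ⊤
  act_rel _ _ := trivial
  invAct_rel _ _ := trivial

/-- The intersection of a set of congruences. -/
def Congr.inter (S : Set (Congr Q)) : Congr Q where
  r a b := ∀ δ ∈ S, δ.toSetoid a b
  iseqv :=
    { refl := fun _ δ _ => δ.refl _
      symm := fun h δ hδ => δ.symm (h δ hδ)
      trans := fun h h' δ hδ => δ.trans (h δ hδ) (h' δ hδ) }
  act_rel h h' δ hδ := δ.act_rel (h δ hδ) (h' δ hδ)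
  invAct_rel h h' δ hδ := δ.invAct_rel (h δ hδ) (h' δ hδ)

/-- The term condition `C(α, β; δ)` of Freese and McKenzie: `α` centralizes `β` modulo `δ`. -/
def Centralizes (α β δ : Congr Q) : Prop :=
  ∀ (m n : ℕ) (t : Term (Fin m ⊕ Fin n)) (a b : Fin m → Q) (u v : Fin n → Q),
    (∀ i, α.toSetoid (a i) (b i)) → (∀ j, β.toSetoid (u j) (v j)) →
    δ.toSetoid (t.eval (Sum.elim a u)) (t.eval (Sum.elim a v)) →
    δ.toSetoid (t.eval (Sum.elim b u)) (t.eval (Sum.elim b v))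

/-- The commutator `[α, β]`: the smallest congruence `δ` with `C(α, β; δ)`. -/
def congComm (α β : Congr Q) : Congr Q :=
  Congr.inter {δ | Centralizes α β δ}

theorem congComm_isLeast (α β : Congr Q) :
    IsLeast {δ | Centralizes α β δ} (congComm α β) :=
  ⟨fun m n t a b u v hab huv h δ hδ => hδ m n t a b u v hab huv (h δ hδ),
    fun δ hδ _ _ h => h δ hδ⟩

/-! ### Relative displacement groups, admissible subgroups and the Galois connection -/

/-- The displacement group relative to `α`: the smallest normal subgroup of `LMlt(Q)`
containing all `L_a L_b⁻¹` with `a α b`. -/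
def Dis (α : Congr Q) : Subgroup (LMlt Q) :=
  Subgroup.normalClosure {g | ∃ a b : Q, α.toSetoid a b ∧ g = L a * (L b)⁻¹}

instance (α : Congr Q) : (Dis α).Normal := Subgroup.normalClosure_normal

theorem Dis_mono {α β : Congr Q} (h : α ≤ β) : Dis α ≤ Dis β :=
  Subgroup.normalClosure_mono fun _ ⟨a, b, hab, hg⟩ => ⟨a, b, h hab, hg⟩

/-- An admissible subgroup: a normal subgroup of `LMlt(Q)` contained in `Dis(Q) = Dis_{1_Q}`. -/
def IsAdmissible (N : Subgroup (LMlt Q)) : Prop :=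
  N.Normal ∧ N ≤ Dis (Congr.full Q)

variable (Q) in
/-- The set `Norm(Q)` of admissible subgroups, ordered by inclusion. -/
abbrev AdmSubgroup : Type u := {N : Subgroup (LMlt Q) // IsAdmissible N}

/-- The map `α ↦ Dis_α` from congruences to admissible subgroups. -/
def DisMap (α : Congr Q) : AdmSubgroup Q :=
  ⟨Dis α, inferInstance, Dis_mono fun _ _ _ => trivial⟩

/-- The group commutator `[M, N]` of admissible subgroups, which is again admissible. -/
def AdmSubgroup.comm (M N : AdmSubgroup Q) : AdmSubgroup Q :=
  ⟨⁅M.1, N.1⁆,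
    have := M.2.1
    have := N.2.1
    ⟨inferInstance, (Subgroup.commutator_le_left M.1 N.1).trans M.2.2⟩⟩

theorem div_mem_iff (N : AdmSubgroup Q) (g h : LMlt Q) :
    g * h⁻¹ ∈ N.1 ↔ (QuotientGroup.mk g : LMlt Q ⧸ N.1) = QuotientGroup.mk h := by
  have := N.2.1
  rw [eq_comm, QuotientGroup.eq, Subgroup.Normal.mem_comm_iff N.2.1]

/-- The congruence `{(a, b) : L_a L_b⁻¹ ∈ N}` induced by an admissible subgroup `N`. -/
def con (N : AdmSubgroup Q) : Congr Q where
  r a b := L a * (L b)⁻¹ ∈ N.1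
  iseqv :=
    { refl := fun a => (div_mem_iff N _ _).2 rfl
      symm := fun h => (div_mem_iff N _ _).2 ((div_mem_iff N _ _).1 h).symm
      trans := fun h h' =>
        (div_mem_iff N _ _).2 (((div_mem_iff N _ _).1 h).trans ((div_mem_iff N _ _).1 h')) }
  act_rel {a b c d} h h' := by
    have := N.2.1
    have h1 := (div_mem_iff N _ _).1 h
    have h2 := (div_mem_iff N _ _).1 h'
    refine (div_mem_iff N _ _).2 ?_
    simp only [L_act, QuotientGroup.mk_mul, QuotientGroup.mk_inv, h1, h2]
  invAct_rel {a b c d} h h' := by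
    have := N.2.1
    have h1 := (div_mem_iff N _ _).1 h
    have h2 := (div_mem_iff N _ _).1 h'
    refine (div_mem_iff N _ _).2 ?_
    simp only [L_invAct, QuotientGroup.mk_mul, QuotientGroup.mk_inv, h1, h2]

theorem galoisConnection_DisMap_con :
    GaloisConnection (DisMap : Congr Q → AdmSubgroup Q) (con : AdmSubgroup Q → Congr Q) := by
  intro α N
  have := N.2.1
  constructor
  · intro h a b hab
    exact h (Subgroup.subset_normalClosure ⟨a, b, hab, rfl⟩)
  · intro h
    refine Subgroup.normalClosure_le_normal ?_
    rintro _ ⟨a, b, hab, rfl⟩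
    exact h hab

end Congr

end QuandleCommutator

/-!
Write `N = ⁅Dis α, Dis β⁆`. Two facts carry the proof.

*Every quotient of a superconnected quandle is faithful* (`IsSuperconnected.rel_of_act_rel`): if
`a` and `b` act in the same way modulo a congruence `δ`, then the union of their `δ`-classes is a
subalgebra on which all left multiplications preserve the `δ`-classes, and its connectedness forces
`a δ b`. Hence `con M ≤ δ` whenever `M` acts trivially modulo `δ` (`con_le_of_le_actKer`). As
`Dis α` acts trivially modulo `α`, this gives `α = con (Dis α)`, and with it the injectivity of
`Dis` and the surjectivity of `con`. If `C(α, β; δ)` holds, then the term condition applied to the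
term `[L_x L_{x'}⁻¹, L_y L_{y'}⁻¹] z` shows that `N` acts trivially modulo `δ`
(`Centralizes.commutator_le_actKer`), so `con N ≤ [α, β]`.

*The map `a ↦ L_a` turns quandle terms into group words*, because `L (a ◃ b) = L a L b (L a)⁻¹`.
In `LMlt(Q) / N` the images of `Dis α` and `Dis β` are normal and commute elementwise, so group
words satisfy the term condition there (`IsRect`). As `con N` is equality of the images of `L` in
that quotient, `C(α, β; con N)` holds (`centralizes_con_commutator`), so `[α, β] ≤ con N`.

Symmetry of `[α, β]` follows from that of the group commutator.
-/

namespace QuandleCommutator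

open scoped Quandles commutatorElement

/-! ### Rectangles modulo two commuting normal subgroups -/

section Rect

variable {H : Type*} [Group H]

/-- The elements `p, q` (first row) and `r, s` (second row) form a rectangle: the rows are congruent
modulo `A`, the columns modulo `B`, and both rows have the same quotient. For normal `A` and `B`,
the congruences `q ≡ s` modulo `A` and `r ≡ s` modulo `B` follow from the others. -/
structure IsRect (A B : Subgroup H) (p q r s : H) : Prop where
  row_mem : p⁻¹ * q ∈ B
  col_mem : r⁻¹ * p ∈ A
  row_eq : p⁻¹ * q = r⁻¹ * s

variable {A B : Subgroup H} {p q r s p' q' r' s' : H}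

/-- Conjugation on `B` only depends on the conjugating element modulo `A`. -/
theorem conj_eq_of_commute [B.Normal] (hAB : ∀ x ∈ A, ∀ y ∈ B, Commute x y)
    (h : r⁻¹ * p ∈ A) {y : H} (hy : y ∈ B) : p⁻¹ * y * p = r⁻¹ * y * r := by
  have hy' : r⁻¹ * y * r ∈ B := by
    simpa using ‹B.Normal›.conj_mem y hy r⁻¹
  have hc := (hAB _ h _ hy').eq
  calc p⁻¹ * y * p = (r⁻¹ * p)⁻¹ * ((r⁻¹ * y * r) * (r⁻¹ * p)) := by group
    _ = r⁻¹ * y * r := by rw [← hc]; group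

theorem IsRect.mul [A.Normal] [B.Normal] (hAB : ∀ x ∈ A, ∀ y ∈ B, Commute x y)
    (h : IsRect A B p q r s) (h' : IsRect A B p' q' r' s') :
    IsRect A B (p * p') (q * q') (r * r') (s * s') where
  row_mem := by
    have h1 := ‹B.Normal›.conj_mem _ h.row_mem p'⁻¹
    have h2 := B.mul_mem h1 h'.row_mem
    convert h2 using 1; group
  col_mem := by
    have h1 := ‹A.Normal›.conj_mem _ h.col_mem r'⁻¹
    have h2 := A.mul_mem h1 h'.col_mem
    convert h2 using 1; group
  row_eq := by
    calc (p * p')⁻¹ * (q * q') = (p'⁻¹ * (p⁻¹ * q) * p') * (p'⁻¹ * q') := by group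
      _ = (r'⁻¹ * (p⁻¹ * q) * r') * (r'⁻¹ * s') := by
        rw [conj_eq_of_commute hAB h'.col_mem h.row_mem, h'.row_eq]
      _ = (r * r')⁻¹ * (s * s') := by rw [h.row_eq]; group

theorem IsRect.inv [A.Normal] [B.Normal] (hAB : ∀ x ∈ A, ∀ y ∈ B, Commute x y)
    (h : IsRect A B p q r s) : IsRect A B p⁻¹ q⁻¹ r⁻¹ s⁻¹ where
  row_mem := by
    have h1 := ‹B.Normal›.conj_mem _ (B.inv_mem h.row_mem) p
    convert h1 using 1; group
  col_mem := by
    have h1 := ‹A.Normal›.conj_mem _ (A.inv_mem h.col_mem) r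
    convert h1 using 1; group
  row_eq := by
    have hA : r⁻¹⁻¹ * p⁻¹ ∈ A := by
      have h1 := ‹A.Normal›.conj_mem _ (A.inv_mem h.col_mem) r
      convert h1 using 1; group
    have hc := conj_eq_of_commute hAB hA (B.inv_mem h.row_mem)
    calc p⁻¹⁻¹ * q⁻¹ = p⁻¹⁻¹ * (p⁻¹ * q)⁻¹ * p⁻¹ := by group
      _ = r⁻¹⁻¹ * (p⁻¹ * q)⁻¹ * r⁻¹ := hc
      _ = r⁻¹⁻¹ * s⁻¹ := by rw [h.row_eq]; group

end Rect

/-! ### Left multiplications modulo a congruence -/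

section Rack

variable {Q : Type*} [Rack Q]

/-- Induction on elements of `LMlt Q` along left multiplications, their inverses and products. -/
theorem LMlt_induction {P : Equiv.Perm Q → Prop} (one : P 1)
    (act : ∀ a : Q, P (Rack.act' a)) (mul : ∀ g h, P g → P h → P (g * h))
    (inv : ∀ g, P g → P g⁻¹) {h : Equiv.Perm Q} (hh : h ∈ LMlt Q) : P h := by
  induction hh using Subgroup.closure_induction with
  | mem x hx => obtain ⟨a, rfl⟩ := hx; exact act a
  | one => exact one
  | mul x y _ _ hx hy => exact mul x y hx hy
  | inv x _ hx => exact inv x hx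

theorem LMlt_rel (δ : Congr Q) (h : LMlt Q) :
    ∀ {x y : Q}, δ.toSetoid x y → δ.toSetoid (h.1 x) (h.1 y) := by
  suffices H : (∀ x y : Q, δ.toSetoid x y → δ.toSetoid (h.1 x) (h.1 y)) ∧
      (∀ x y : Q, δ.toSetoid x y → δ.toSetoid (h.1⁻¹ x) (h.1⁻¹ y)) from fun {x y} => H.1 x y
  refine LMlt_induction (P := fun g => (∀ x y : Q, δ.toSetoid x y → δ.toSetoid (g x) (g y)) ∧
      (∀ x y : Q, δ.toSetoid x y → δ.toSetoid (g⁻¹ x) (g⁻¹ y)))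
    ⟨fun _ _ h => h, fun _ _ h => h⟩
    (fun a => ⟨fun _ _ h => δ.act_rel (δ.refl a) h, fun _ _ h => δ.invAct_rel (δ.refl a) h⟩)
    (fun g h hg hh => ⟨fun x y hxy => hg.1 _ _ (hh.1 _ _ hxy), fun x y hxy => ?_⟩)
    (fun g hg => ⟨hg.2, fun x y hxy => by rw [inv_inv]; exact hg.1 x y hxy⟩) h.2
  rw [mul_inv_rev]
  exact hh.2 _ _ (hg.2 _ _ hxy)

theorem L_apply_eq_conj (h : LMlt Q) (a : Q) : L (h.1 a) = h * L a * h⁻¹ := by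
  suffices H : ∀ a : Q, (L (h.1 a) : Equiv.Perm Q) = h.1 * L a * h.1⁻¹ from Subtype.ext (H a)
  refine LMlt_induction (P := fun g => ∀ a : Q, (L (g a) : Equiv.Perm Q) = g * L a * g⁻¹)
    (fun a => by simp) (fun b a => congrArg Subtype.val (L_act b a))
    (fun g h hg hh a => ?_) (fun g hg a => ?_) h.2
  · rw [Equiv.Perm.mul_apply, hg, hh]; group
  · have h1 : (L a : Equiv.Perm Q) = g * L (g⁻¹ a) * g⁻¹ := by
      rw [← hg, Equiv.Perm.inv_def, Equiv.apply_symm_apply]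
    rw [h1]; group

/-- The subgroup of those elements of `LMlt Q` that act trivially modulo `δ`. -/
def actKer (δ : Congr Q) : Subgroup (LMlt Q) where
  carrier := {h | ∀ c : Q, δ.toSetoid (h.1 c) c}
  one_mem' c := δ.refl c
  mul_mem' {g h} hg hh c := δ.trans (hg (h.1 c)) (hh c)
  inv_mem' {g} hg c := by
    have h := hg (g.1⁻¹ c)
    rw [Equiv.Perm.inv_def, Equiv.apply_symm_apply] at h
    exact δ.symm h

theorem mem_actKer {δ : Congr Q} {h : LMlt Q} :
    h ∈ actKer δ ↔ ∀ c : Q, δ.toSetoid (h.1 c) c := Iff.rfl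

instance (δ : Congr Q) : (actKer δ).Normal where
  conj_mem n hn g c := by
    have h := LMlt_rel δ g (hn (g.1⁻¹ c))
    rw [Equiv.Perm.inv_def, Equiv.apply_symm_apply] at h
    exact h

theorem Dis_le_actKer (α : Congr Q) : Dis α ≤ actKer α := by
  refine Subgroup.normalClosure_le_normal ?_
  rintro _ ⟨a, b, hab, rfl⟩ c
  have h := α.act_rel hab (α.refl (b ◃⁻¹ c))
  rwa [Rack.act_invAct_eq] at h

/-- The generators of `Dis α` are permuted by conjugation, so they generate it as a subgroup. -/
theorem Dis_eq_closure (α : Congr Q) :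
    Dis α = Subgroup.closure {g | ∃ a b : Q, α.toSetoid a b ∧ g = L a * (L b)⁻¹} := by
  refine le_antisymm (Subgroup.closure_mono ?_) Subgroup.closure_le_normalClosure
  intro g hg
  obtain ⟨_, ⟨a, b, hab, rfl⟩, hc⟩ := Group.mem_conjugatesOfSet_iff.1 hg
  obtain ⟨h, rfl⟩ := isConj_iff.1 hc
  refine ⟨h.1 a, h.1 b, LMlt_rel α h hab, ?_⟩
  rw [L_apply_eq_conj, L_apply_eq_conj]; group

/-! ### The term condition and the group commutator -/

/-- The term `[L_x L_{x'}⁻¹, L_y L_{y'}⁻¹] z`, where `x = x_0` and the variables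
`x', y, y', z` are `y_0, y_1, y_2, y_3`. In its use below `x` varies along `α`, `y` varies along `β`,
and `x', y', z` stay constant. -/
def commTerm : Term (Fin 1 ⊕ Fin 4) :=
  let x := Term.var (.inl 0)
  let x' := Term.var (.inr 0)
  let y := Term.var (.inr 1)
  let y' := Term.var (.inr 2)
  let z := Term.var (.inr 3)
  .act x <| .invAct x' <| .act y <| .invAct y' <| .act x' <| .invAct x <| .act y' <| .invAct y z

theorem Centralizes.commutator_le_actKer {α β δ : Congr Q} (h : Centralizes α β δ) :
    ⁅Dis α, Dis β⁆ ≤ actKer δ := by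
  have key : ∀ a b u v : Q, α.toSetoid a b → β.toSetoid u v →
      ⁅L a * (L b)⁻¹, L u * (L v)⁻¹⁆ ∈ actKer δ := by
    intro a b u v hab huv c
    -- At `x = x' = b` the term takes the value `c` both for `y = u` and for `y = v`.
    have h1 := h 1 4 commTerm ![b] ![a] ![b, v, v, c] ![b, u, v, c]
      (by intro i; fin_cases i; exact α.symm hab)
      (by
        intro j
        fin_cases j
        exacts [β.refl _, β.symm huv, β.refl _, β.refl _])
      (by simp [commTerm, Term.eval, Rack.act_invAct_eq, Rack.invAct_act_eq])
    have h2 : δ.toSetoid c (a ◃ b ◃⁻¹ u ◃ v ◃⁻¹ b ◃ a ◃⁻¹ v ◃ u ◃⁻¹ c) := by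
      simpa [commTerm, Term.eval, Rack.act_invAct_eq, Rack.invAct_act_eq] using h1
    have h3 : (⁅L a * (L b)⁻¹, L u * (L v)⁻¹⁆ : LMlt Q).1 c =
        a ◃ b ◃⁻¹ u ◃ v ◃⁻¹ b ◃ a ◃⁻¹ v ◃ u ◃⁻¹ c := by
      rw [commutatorElement_def, mul_inv_rev, mul_inv_rev, inv_inv, inv_inv]
      rfl
    rw [h3]
    exact δ.symm h2
  let π := QuotientGroup.mk' (actKer δ)
  have hπ : ∀ g : LMlt Q, π g = 1 ↔ g ∈ actKer δ := fun g => QuotientGroup.eq_one_iff g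
  suffices H : ⁅(Dis α).map π, (Dis β).map π⁆ = ⊥ by
    rw [← Subgroup.map_commutator, Subgroup.map_eq_bot_iff] at H
    simpa only [π, QuotientGroup.ker_mk'] using H
  rw [Subgroup.commutator_eq_bot_iff_le_centralizer, Dis_eq_closure α, Dis_eq_closure β,
    MonoidHom.map_closure, MonoidHom.map_closure, Subgroup.centralizer_closure, Subgroup.closure_le]
  rintro _ ⟨_, ⟨a, b, hab, rfl⟩, rfl⟩
  rw [SetLike.mem_coe, Subgroup.mem_centralizer_iff_commutator_eq_one]
  rintro _ ⟨_, ⟨u, v, huv, rfl⟩, rfl⟩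
  rw [← map_commutatorElement, ← commutatorElement_inv, map_inv,
    inv_eq_one, hπ]
  exact key a b u v hab huv

theorem isRect_eval {H : Type*} [Group H] {A B : Subgroup H} [A.Normal] [B.Normal]
    (hAB : ∀ x ∈ A, ∀ y ∈ B, Commute x y) (φ : LMlt Q →* H) {X Y : Type} {a b : X → Q}
    {u v : Y → Q} (hab : ∀ i, (φ (L (b i)))⁻¹ * φ (L (a i)) ∈ A)
    (huv : ∀ j, (φ (L (u j)))⁻¹ * φ (L (v j)) ∈ B) (t : Term (X ⊕ Y)) :
    IsRect A B
      (φ (L (t.eval (Sum.elim a u)))) (φ (L (t.eval (Sum.elim a v))))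
      (φ (L (t.eval (Sum.elim b u)))) (φ (L (t.eval (Sum.elim b v)))) := by
  induction t with
  | var x =>
    cases x with
    | inl i => exact ⟨by simp [Term.eval, B.one_mem], hab i, by simp [Term.eval]⟩
    | inr j => exact ⟨huv j, by simp [Term.eval, A.one_mem], rfl⟩
  | act s t hs ht =>
    simp only [Term.eval, L_act, map_mul, map_inv]
    exact (hs.mul hAB ht).mul hAB (hs.inv hAB)
  | invAct s t hs ht =>
    simp only [Term.eval, L_invAct, map_mul, map_inv]
    exact ((hs.inv hAB).mul hAB ht).mul hAB hs

theorem map_L_inv_mul_mem {H : Type*} [Group H] (φ : LMlt Q →* H) (γ : Congr Q) {x y : Q}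
    (hxy : γ.toSetoid x y) : (φ (L x))⁻¹ * φ (L y) ∈ (Dis γ).map φ := by
  have h1 : L y * (L x)⁻¹ ∈ Dis γ := Subgroup.subset_normalClosure ⟨y, x, γ.symm hxy, rfl⟩
  exact ⟨(L x)⁻¹ * L y, (Subgroup.Normal.mem_comm_iff inferInstance).1 h1, by simp⟩

/-- The four values of `L ∘ t` at `(a, u), (a, v), (b, u), (b, v)` form a rectangle in `LMlt(Q)`
modulo the commutator; if its first row is constant, so is its second. -/
theorem centralizes_con_commutator (α β : Congr Q) :
    Centralizes α β (con (AdmSubgroup.comm (DisMap α) (DisMap β))) := by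
  intro m n t a b u v hab huv h
  let π : LMlt Q →* LMlt Q ⧸ ⁅Dis α, Dis β⁆ := QuotientGroup.mk' _
  have hπ : Function.Surjective π := QuotientGroup.mk'_surjective _
  have : ((Dis α).map π).Normal := Subgroup.Normal.map inferInstance π hπ
  have : ((Dis β).map π).Normal := Subgroup.Normal.map inferInstance π hπ
  have hAB : ∀ x ∈ (Dis α).map π, ∀ y ∈ (Dis β).map π, Commute x y := by
    rintro _ ⟨x, hx, rfl⟩ _ ⟨y, hy, rfl⟩
    rw [← commutatorElement_eq_one_iff_commute, ← map_commutatorElement]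
    exact (QuotientGroup.eq_one_iff _).2 (Subgroup.commutator_mem_commutator hx hy)
  have h1 := (isRect_eval hAB π (fun i => map_L_inv_mul_mem π α (α.symm (hab i)))
    (fun j => map_L_inv_mul_mem π β (huv j)) t).row_eq
  have h2 : π (L (t.eval (Sum.elim a u))) = π (L (t.eval (Sum.elim a v))) :=
    (div_mem_iff (AdmSubgroup.comm (DisMap α) (DisMap β)) _ _).1 h
  rw [h2, inv_mul_cancel, eq_comm, inv_mul_eq_one] at h1
  exact (div_mem_iff (AdmSubgroup.comm (DisMap α) (DisMap β)) _ _).2 h1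

theorem AdmSubgroup.comm_comm (M N : AdmSubgroup Q) :
    AdmSubgroup.comm M N = AdmSubgroup.comm N M :=
  Subtype.ext (Subgroup.commutator_comm M.1 N.1)

end Rack

/-! ### Faithfulness of the quotients of a superconnected quandle -/

section Quandle

variable {Q : Type*} [Quandle Q]

theorem IsSuperconnected.rel_of_act_rel (hQ : IsSuperconnected Q) (δ : Congr Q) {a b : Q}
    (hab : ∀ c : Q, δ.toSetoid (a ◃ c) (b ◃ c)) : δ.toSetoid a b := by
  -- Both `a` and `b` act trivially modulo `δ` on the union of their classes.
  have triv : ∀ {x y : Q}, (δ.toSetoid x a ∨ δ.toSetoid x b) →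
      (δ.toSetoid y a ∨ δ.toSetoid y b) → δ.toSetoid (x ◃ y) y := by
    intro x y hx hy
    have hxa : δ.toSetoid (x ◃ y) (a ◃ y) := by
      rcases hx with hx | hx
      · exact δ.act_rel hx (δ.refl y)
      · exact δ.trans (δ.act_rel hx (δ.refl y)) (δ.symm (hab y))
    refine δ.trans hxa ?_
    rcases hy with hy | hy
    · have h1 := δ.act_rel (δ.refl a) hy
      rw [Quandle.fix] at h1
      exact δ.trans h1 (δ.symm hy)
    · have h1 := δ.trans (hab y) (δ.act_rel (δ.refl b) hy)
      rw [Quandle.fix] at h1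
      exact δ.trans h1 (δ.symm hy)
  have triv' : ∀ {x y : Q}, (δ.toSetoid x a ∨ δ.toSetoid x b) →
      (δ.toSetoid y a ∨ δ.toSetoid y b) → δ.toSetoid (x ◃⁻¹ y) y := by
    intro x y hx hy
    have h1 := δ.invAct_rel (δ.refl x) (triv hx hy)
    rw [Rack.invAct_act_eq] at h1
    exact δ.symm h1
  obtain ⟨M, hM⟩ : ∃ M : Subalg Q, ∀ x, x ∈ M.carrier ↔ δ.toSetoid x a ∨ δ.toSetoid x b :=
    ⟨{ carrier := {x | δ.toSetoid x a ∨ δ.toSetoid x b}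
       act_mem := fun hx hy => hy.imp (δ.trans (triv hx hy)) (δ.trans (triv hx hy))
       invAct_mem := fun hx hy => hy.imp (δ.trans (triv' hx hy)) (δ.trans (triv' hx hy)) },
      fun _ => Iff.rfl⟩
  obtain ⟨h, hh, e⟩ := hQ M ⟨a, (hM a).2 (.inl (δ.refl a))⟩ ⟨b, (hM b).2 (.inr (δ.refl b))⟩
  have hfix : ∀ x : M.carrier, δ.toSetoid (h x).1 x.1 := by
    refine LMlt_induction (P := fun g => ∀ x : M.carrier, δ.toSetoid (g x).1 x.1)
      (fun x => δ.refl _) (fun y x => triv ((hM y).1 y.2) ((hM x).1 x.2))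
      (fun g k hg hk x => δ.trans (hg (k x)) (hk x)) (fun g hg x => ?_) hh
    have h1 := hg (g⁻¹ x)
    rw [Equiv.Perm.inv_def, Equiv.apply_symm_apply] at h1
    exact δ.symm h1
  have h1 := hfix ⟨a, (hM a).2 (.inl (δ.refl a))⟩
  rw [e] at h1
  exact δ.symm h1

theorem con_le_of_le_actKer (hQ : IsSuperconnected Q) {N : AdmSubgroup Q} {δ : Congr Q}
    (h : N.1 ≤ actKer δ) : con N ≤ δ := by
  intro a b hab
  refine hQ.rel_of_act_rel δ fun c => ?_
  have h1 := mem_actKer.1 (h hab) (b ◃ c)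
  have h2 : (L a * (L b)⁻¹ : LMlt Q).1 (b ◃ c) = a ◃ c :=
    congrArg (a ◃ ·) (Rack.invAct_act_eq b c)
  rwa [h2] at h1

theorem con_DisMap (hQ : IsSuperconnected Q) (α : Congr Q) : con (DisMap α) = α :=
  le_antisymm (con_le_of_le_actKer hQ (Dis_le_actKer α)) (galoisConnection_DisMap_con.le_u_l α)

theorem congComm_eq_con (hQ : IsSuperconnected Q) (α β : Congr Q) :
    congComm α β = con (AdmSubgroup.comm (DisMap α) (DisMap β)) :=
  le_antisymm ((congComm_isLeast α β).2 (centralizes_con_commutator α β))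
    (con_le_of_le_actKer hQ (congComm_isLeast α β).1.commutator_le_actKer)

end Quandle

end QuandleCommutator

open QuandleCommutator in
theorem mainTheorem9 (Q : Type*) [Quandle Q] (hQ : IsSuperconnected Q) :
    (∀ α : Congr Q, α = con (DisMap α)) ∧
    (∀ α β : Congr Q,
      congComm α β = congComm β α ∧
      congComm α β = con (AdmSubgroup.comm (DisMap α) (DisMap β))) ∧
    Function.Injective (DisMap : Congr Q → AdmSubgroup Q) ∧
    Function.Surjective (con : AdmSubgroup Q → Congr Q) := by
  refine ⟨fun α => (con_DisMap hQ α).symm, fun α β => ⟨?_, congComm_eq_con hQ α β⟩,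
    Function.LeftInverse.injective (con_DisMap hQ),
    Function.RightInverse.surjective (con_DisMap hQ)⟩
  rw [congComm_eq_con hQ, congComm_eq_con hQ, AdmSubgroup.comm_comm]
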